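/- Let $X$ be a compact convex subset of a Hausdorff locally convex real topological vector space. Let $A_b(X)$ be the Banach space of bounded real affine functions on $X$ (supremum norm, pointwise order), and let $A_c(X)\subset A_b(X)$ be the subspace of continuous affine functions. Let $H$ be an intermediate function space on $X$, i.e. a closed linear subspace with $A_c(X)\subset H\subset A_b(X)$. Assume that $H$ is determined by extreme points, i.e. $\inf u(\operatorname{ext}X)\le u\le\sup u(\operatorname{ext}X)$ on $X$ for every $u\in H$. For a space $W$ of bounded functions containing the constant function $1$, let $\mathfrak D(W)$ be the set of bounded linear operators $T:W\to W$ such that for some $\lambda\ge 0$ we have $-\lambda f\le Tf\le\lambda f$ for all $0\le f\in W$. Put $$Z(H)=\{T(1):T\in\mathfrak D(H)\},\qquad M(H)=\{u\in H:\ \forall a\in H\ \exists b\in H:\ b=u\cdot a\text{ on }\operatorname{ext}X\}.$$ Let $S(H)=\{\varphi\in H^*:\|\varphi\|\le 1,\ \varphi(1)=1\}$ be the state space of $H$ with the weak$^*$ topology, and let $\iota:X\to S(H)$ be the evaluation map $\iota(x)(a)=a(x)$, $a\in H$. For a compact convex set $Y$ put $$m(Y)=\{y\in Y:\ T(a)(y)=T(1)(y)\cdot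 a(y)\ \text{ for all } T\in\mathfrak D(A_c(Y)),\ a\in A_c(Y)\}.$$ Then $Z(H)=M(H)$ if and only if $\iota(\operatorname{ext}X)\subset m(S(H))$. -/

import Mathlib

open scoped ENNReal

noncomputable section

namespace CompactConvex

/-- The Banach space of all bounded real functions on `Γ`, with the supremum norm. Its elements
are ordered pointwise. -/
abbrev BddFun (Γ : Type*) : Type _ := lp (fun _ : Γ => ℝ) ∞

section Affine

variable {E : Type*} [AddCommGroup E] [Module ℝ E]

/-- A function on a convex set `X` is affine if it respects convex combinations. -/
def IsAffine (X : Set E) (f : X → ℝ) : Prop :=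
  ∀ (x y z : X) (s t : ℝ), 0 ≤ s → 0 ≤ t → s + t = 1 →
    (z : E) = s • (x : E) + t • (y : E) → f z = s * f x + t * f y

/-- `A_b(X)`: the bounded affine functions on `X`. -/
def affineBdd (X : Set E) : Submodule ℝ (BddFun X) where
  carrier := {f | IsAffine X f}
  zero_mem' := by
    intro x y z s t _ _ _ _
    simp
  add_mem' := by
    intro f g hf hg x y z s t hs ht hst hz
    have h1 := hf x y z s t hs ht hst hz
    have h2 := hg x y z s t hs ht hst hz
    simp only [lp.coeFn_add, Pi.add_apply, h1, h2]
    ring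
  smul_mem' := by
    intro c f hf x y z s t hs ht hst hz
    have h1 := hf x y z s t hs ht hst hz
    simp only [lp.coeFn_smul, Pi.smul_apply, smul_eq_mul, h1]
    ring

/-- `A_c(X)`: the continuous affine functions on `X` (for compact `X` these are automatically
bounded). -/
def affineCont [TopologicalSpace E] (X : Set E) : Submodule ℝ (BddFun X) where
  carrier := {f | IsAffine X f ∧ Continuous (f : X → ℝ)}
  zero_mem' := ⟨(affineBdd X).zero_mem, by
    rw [lp.coeFn_zero]; exact continuous_zero⟩
  add_mem' := by
    rintro f g ⟨hf, hf'⟩ ⟨hg, hg'⟩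
    exact ⟨(affineBdd X).add_mem hf hg, by rw [lp.coeFn_add]; exact hf'.add hg'⟩
  smul_mem' := by
    rintro c f ⟨hf, hf'⟩
    exact ⟨(affineBdd X).smul_mem c hf, by rw [lp.coeFn_smul]; exact hf'.const_smul c⟩

theorem one_mem_affineCont [TopologicalSpace E] (X : Set E) :
    (1 : BddFun X) ∈ affineCont X := by
  refine ⟨?_, ?_⟩
  · intro x y z s t _ _ hst _
    simp [lp.infty_coeFn_one, hst]
  · rw [lp.infty_coeFn_one]
    exact continuous_const

end Affine

section Center

variable {Γ : Type*}

/-- The ideal center `𝔇(W)` of a space `W` of bounded functions: the bounded linear operators `T`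
on `W` with `-c I ≤ T ≤ c I` for some `c ≥ 0`. Here `S ≤ T` means `S f ≤ T f` pointwise for all
`f ≥ 0` in `W`. -/
def idealCenter (W : Submodule ℝ (BddFun Γ)) : Set (W →L[ℝ] W) :=
  {T | ∃ c : ℝ, 0 ≤ c ∧ ∀ f : W, (∀ x, 0 ≤ (f : BddFun Γ) x) →
    ∀ x, -(c * (f : BddFun Γ) x) ≤ (T f : BddFun Γ) x ∧
      (T f : BddFun Γ) x ≤ c * (f : BddFun Γ) x}

/-- The center `Z(W) = {T 1 : T ∈ 𝔇(W)}` of a space `W` of bounded functions that contains the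
constant function `1`. -/
def center (W : Submodule ℝ (BddFun Γ)) (h1 : (1 : BddFun Γ) ∈ W) : Set (BddFun Γ) :=
  {u | ∃ T ∈ idealCenter W, u = (T ⟨1, h1⟩ : BddFun Γ)}

end Center

/-- The state space `{φ ∈ A* : ‖φ‖ ≤ 1, φ(e) = 1}` of a normed space `A` with unit `e`, as a
subset of the dual with the weak* topology. -/
def stateSpace (A : Type*) [NormedAddCommGroup A] [NormedSpace ℝ A] (e : A) :
    Set (WeakDual ℝ A) :=
  {φ | ‖WeakDual.toStrongDual φ‖ ≤ 1 ∧ φ e = 1}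

section Spaces

variable {E : Type*} [AddCommGroup E] [Module ℝ E] [TopologicalSpace E]

/-- The extreme points of `X`, as points of the subtype `X`. -/
def extPts (X : Set E) : Set X := {x | (x : E) ∈ X.extremePoints ℝ}

/-- An intermediate function space on `X`: a closed subspace `H` of `A_b(X)` containing
`A_c(X)`. -/
structure IsIntermediateFunctionSpace (X : Set E) (H : Submodule ℝ (BddFun X)) : Prop where
  affineCont_le : affineCont X ≤ H
  le_affineBdd : H ≤ affineBdd X
  isClosed : IsClosed (H : Set (BddFun X))

theorem IsIntermediateFunctionSpace.one_mem {X : Set E} {H : Submodule ℝ (BddFun X)}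
    (hH : IsIntermediateFunctionSpace X H) : (1 : BddFun X) ∈ H :=
  hH.affineCont_le (one_mem_affineCont X)

/-- `H` is determined by extreme points: `inf u(ext X) ≤ u ≤ sup u(ext X)` for all `u ∈ H`. -/
def DeterminedByExtremePoints (X : Set E) (H : Submodule ℝ (BddFun X)) : Prop :=
  ∀ u ∈ H, ∀ x : X,
    sInf ((u : X → ℝ) '' extPts X) ≤ u x ∧ u x ≤ sSup ((u : X → ℝ) '' extPts X)

/-- The multipliers `M(H)`. -/
def multipliers (X : Set E) (H : Submodule ℝ (BddFun X)) : Set (BddFun X) :=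
  {u | u ∈ H ∧ ∀ a ∈ H, ∃ b ∈ H, ∀ x ∈ extPts X, b x = u x * a x}

/-- The set `m(Y)` of those `y ∈ Y` such that `(T a)(y) = (T 1)(y) · a(y)` for all `a ∈ A_c(Y)`
and all `T` in the ideal center of `A_c(Y)`. -/
def multSet (Y : Set E) : Set Y :=
  {y | ∀ T ∈ idealCenter (affineCont Y), ∀ a : affineCont Y,
    (T a : BddFun Y) y =
      (T ⟨1, one_mem_affineCont Y⟩ : BddFun Y) y * (a : BddFun Y) y}

end Spaces

section Evaluation

variable {Γ : Type*}

theorem norm_apply_le (W : Submodule ℝ (BddFun Γ)) (x : Γ) (a : W) :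
    ‖(a : BddFun Γ) x‖ ≤ 1 * ‖a‖ := by
  rw [one_mul]
  exact lp.norm_apply_le_norm ENNReal.top_ne_zero (a : BddFun Γ) x

/-- Evaluation at `x`, as a functional on `W`. -/
def evalFunctional (W : Submodule ℝ (BddFun Γ)) (x : Γ) : StrongDual ℝ W :=
  LinearMap.mkContinuous
    { toFun := fun a => (a : BddFun Γ) x
      map_add' := fun _ _ => rfl
      map_smul' := fun _ _ => rfl } 1 (norm_apply_le W x)

/-- The evaluation map `ι : Γ → S(W)`, `ι(x)(a) = a(x)`. -/
def evalState (W : Submodule ℝ (BddFun Γ)) (h1 : (1 : BddFun Γ) ∈ W) (x : Γ) :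
    stateSpace W ⟨1, h1⟩ :=
  ⟨StrongDual.toWeakDual (evalFunctional W x),
    LinearMap.mkContinuous_norm_le _ zero_le_one (norm_apply_le W x), by
      change ((1 : BddFun Γ) : Γ → ℝ) x = 1
      rw [lp.infty_coeFn_one]; rfl⟩

end Evaluation

end CompactConvex

end

/-!
Write `S` for the state space of `H`. A function in `H` is nonnegative on `X` if and only if every
state is nonnegative at it, so sending `a ∈ H` to `φ ↦ φ a` is an order isomorphism from `H` into
`A_c(S)`, and it is isometric. It is onto (`stateEval_surjective`): separating the graph of a
continuous affine function `g` on `S` from its translate by `ε` in `H* × ℝ` gives an element of `H`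
that lies within `ε` of `g`, and `H` is complete. Hence the operators in the ideal center of
`A_c(S)` are exactly the conjugates of those in the ideal center of `H`, and
`ι(ext X) ⊆ m(S)` says that `(T a)(x) = (T 1)(x) a(x)` for `T ∈ 𝔇(H)`, `a ∈ H` and `x ∈ ext X`
(`image_evalState_subset_multSet_iff`).

A multiplier `u` determines an operator `T ∈ 𝔇(H)` with `T a = u a` on `ext X`, because elements of
`H` are determined by their values on `ext X`; in particular `M(H) ⊆ Z(H)`. The displayed identity
gives `Z(H) ⊆ M(H)` at once. Conversely, if `T 1` is a multiplier, then `T` and the operator it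
determines agree at `1`, and they are equal because `T ↦ T 1` is injective on `𝔇(H)`
(`eq_zero_of_mem_idealCenter`). That injectivity comes from the extreme points of `S`: if `φ` is an
extreme state and `0 ≤ T ≤ 1`, then `φ ∘ T` lies between `0` and `φ`, so it is a multiple of `φ`,
and by the Krein–Milman theorem extreme states separate the elements of `H`.
-/

open scoped ENNReal

noncomputable section

namespace CompactConvex

/-! ### States of a space of bounded functions -/

section States

variable {Γ : Type*} {W : Submodule ℝ (BddFun Γ)}

theorem abs_apply_le_norm (f : W) (x : Γ) : |(f : BddFun Γ) x| ≤ ‖f‖ := by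
  simpa using norm_apply_le W x f

theorem abs_map_le_of_nonneg (h1 : (1 : BddFun Γ) ∈ W) (ψ : StrongDual ℝ W)
    (hψ : ∀ f : W, (∀ x, 0 ≤ (f : BddFun Γ) x) → 0 ≤ ψ f) (f : W) :
    |ψ f| ≤ ψ ⟨1, h1⟩ * ‖f‖ := by
  have hb := fun x => abs_le.1 (abs_apply_le_norm f x)
  have hm := hψ (‖f‖ • (⟨1, h1⟩ : W) - f) (fun x => by
    change 0 ≤ ‖f‖ * 1 - (f : BddFun Γ) x
    linarith [(hb x).2])
  have hp := hψ (‖f‖ • (⟨1, h1⟩ : W) + f) (fun x => by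
    change 0 ≤ ‖f‖ * 1 + (f : BddFun Γ) x
    linarith [(hb x).1])
  simp only [map_add, map_sub, map_smul, smul_eq_mul] at hm hp
  rw [abs_le]
  constructor <;> linarith

theorem mem_stateSpace_of_nonneg (h1 : (1 : BddFun Γ) ∈ W) (φ : StrongDual ℝ W)
    (hφ : ∀ f : W, (∀ x, 0 ≤ (f : BddFun Γ) x) → 0 ≤ φ f) (hφ1 : φ ⟨1, h1⟩ = 1) :
    StrongDual.toWeakDual φ ∈ stateSpace W ⟨1, h1⟩ := by
  refine ⟨φ.opNorm_le_bound zero_le_one fun f => ?_, hφ1⟩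
  simpa [hφ1] using abs_map_le_of_nonneg h1 φ hφ f

theorem stateSpace_apply_le_norm {A : Type*} [NormedAddCommGroup A] [NormedSpace ℝ A] {e : A}
    {φ : WeakDual ℝ A} (hφ : φ ∈ stateSpace A e) (a : A) : |φ a| ≤ ‖a‖ := by
  simpa using (WeakDual.toStrongDual φ).le_of_opNorm_le hφ.1 a

/-- States are positive, because `‖‖f‖ • 1 - f‖ ≤ ‖f‖` when `0 ≤ f`. -/
theorem stateSpace_apply_nonneg {h1 : (1 : BddFun Γ) ∈ W} {φ : WeakDual ℝ W}
    (hφ : φ ∈ stateSpace W ⟨1, h1⟩) {f : W} (hf : ∀ x, 0 ≤ (f : BddFun Γ) x) : 0 ≤ φ f := by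
  have hn : ‖‖f‖ • (⟨1, h1⟩ : W) - f‖ ≤ ‖f‖ := by
    refine lp.norm_le_of_forall_le (norm_nonneg f) fun x => ?_
    have hb := abs_le.1 (abs_apply_le_norm f x)
    change |‖f‖ * 1 - (f : BddFun Γ) x| ≤ ‖f‖
    rw [abs_le]
    constructor <;> linarith [hf x]
  have h := (abs_le.1 ((stateSpace_apply_le_norm hφ _).trans hn)).2
  rw [map_sub, map_smul, hφ.2, smul_eq_mul] at h
  linarith

theorem convex_stateSpace (A : Type*) [NormedAddCommGroup A] [NormedSpace ℝ A] (e : A) :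
    Convex ℝ (stateSpace A e) := by
  rintro φ ⟨hφ, hφ1⟩ ψ ⟨hψ, hψ1⟩ s t hs ht hst
  refine ⟨?_, ?_⟩
  · simpa using convex_closedBall (0 : StrongDual ℝ A) 1 (mem_closedBall_zero_iff.2 hφ)
      (mem_closedBall_zero_iff.2 hψ) hs ht hst
  · change s * φ e + t * ψ e = 1
    rw [hφ1, hψ1]
    linarith

theorem isCompact_stateSpace (A : Type*) [NormedAddCommGroup A] [NormedSpace ℝ A] (e : A) :
    IsCompact (stateSpace A e) := by
  have h := (WeakDual.isCompact_closedBall (0 : StrongDual ℝ A) 1).inter_right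
    (isClosed_eq (WeakDual.eval_continuous e) (continuous_const (y := (1 : ℝ))))
  convert h using 1
  ext φ
  simp [stateSpace]

instance locallyConvexSpace_weakDual (A : Type*) [NormedAddCommGroup A] [NormedSpace ℝ A] :
    LocallyConvexSpace ℝ (WeakDual ℝ A) :=
  inferInstanceAs (LocallyConvexSpace ℝ (WeakBilin (topDualPairing ℝ A)))

/-- A positive functional dominated by an extreme state is a multiple of it. -/
theorem eq_mul_of_le_extreme {h1 : (1 : BddFun Γ) ∈ W} {φ : WeakDual ℝ W}
    (hφ : φ ∈ (stateSpace W ⟨1, h1⟩).extremePoints ℝ) (ψ : StrongDual ℝ W)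
    (hψ : ∀ f : W, (∀ x, 0 ≤ (f : BddFun Γ) x) → 0 ≤ ψ f ∧ ψ f ≤ φ f) (f : W) :
    ψ f = ψ ⟨1, h1⟩ * φ f := by
  have h1' : ∀ x, 0 ≤ ((⟨1, h1⟩ : W) : BddFun Γ) x := fun x => zero_le_one' ℝ
  have hψ0 := abs_map_le_of_nonneg h1 ψ (fun f hf => (hψ f hf).1) f
  have hψ1 := abs_map_le_of_nonneg h1 (WeakDual.toStrongDual φ - ψ)
    (fun f hf => sub_nonneg.2 (hψ f hf).2) f
  change |φ f - ψ f| ≤ (φ ⟨1, h1⟩ - ψ ⟨1, h1⟩) * ‖f‖ at hψ1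
  have hb := hψ _ h1'
  rw [hφ.1.2] at hψ1 hb
  set t := ψ ⟨1, h1⟩
  rcases hb.1.eq_or_lt with h0 | h0
  · rw [← h0, zero_mul] at hψ0 ⊢
    exact abs_nonpos_iff.1 hψ0
  rcases hb.2.eq_or_lt with h2 | h2
  · rw [h2, sub_self, zero_mul] at hψ1
    have := abs_nonpos_iff.1 hψ1
    rw [h2]
    linarith
  -- `φ` is the convex combination `t • (t⁻¹ • ψ) + (1 - t) • ((1 - t)⁻¹ • (φ - ψ))` of states.
  have h3 : 0 < 1 - t := sub_pos.2 h2
  have hA : StrongDual.toWeakDual (t⁻¹ • ψ) ∈ stateSpace W ⟨1, h1⟩ := by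
    refine mem_stateSpace_of_nonneg h1 _ (fun g hg => ?_) ?_
    · exact mul_nonneg (inv_nonneg.2 h0.le) (hψ g hg).1
    · exact inv_mul_cancel₀ h0.ne'
  have hB : StrongDual.toWeakDual ((1 - t)⁻¹ • (WeakDual.toStrongDual φ - ψ)) ∈
      stateSpace W ⟨1, h1⟩ := by
    refine mem_stateSpace_of_nonneg h1 _ (fun g hg => ?_) ?_
    · exact mul_nonneg (inv_nonneg.2 h3.le) (sub_nonneg.2 (hψ g hg).2)
    · change (1 - t)⁻¹ * (φ ⟨1, h1⟩ - t) = 1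
      rw [hφ.1.2]
      exact inv_mul_cancel₀ h3.ne'
  have hseg : φ ∈ openSegment ℝ (StrongDual.toWeakDual (t⁻¹ • ψ))
      (StrongDual.toWeakDual ((1 - t)⁻¹ • (WeakDual.toStrongDual φ - ψ))) := by
    refine ⟨t, 1 - t, h0, h3, by ring, ?_⟩
    refine DFunLike.ext _ _ fun g => ?_
    change t * (t⁻¹ * ψ g) + (1 - t) * ((1 - t)⁻¹ * (φ g - ψ g)) = φ g
    rw [mul_inv_cancel_left₀ h0.ne', mul_inv_cancel_left₀ h3.ne']
    ring
  have heq := hφ.2 hA hB hseg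
  have := DFunLike.congr_fun heq f
  change t⁻¹ * ψ f = φ f at this
  rw [← this, mul_inv_cancel_left₀ h0.ne']

end States

/-! ### The ideal center -/

section IdealCenter

variable {Γ : Type*} {W : Submodule ℝ (BddFun Γ)}

theorem sub_mem_idealCenter {S T : W →L[ℝ] W} (hS : S ∈ idealCenter W) (hT : T ∈ idealCenter W) :
    S - T ∈ idealCenter W := by
  obtain ⟨c, hc, hS⟩ := hS
  obtain ⟨d, hd, hT⟩ := hT
  refine ⟨c + d, add_nonneg hc hd, fun f hf x => ?_⟩
  have h1 := hS f hf x
  have h2 := hT f hf x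
  change -((c + d) * (f : BddFun Γ) x) ≤ (S f : BddFun Γ) x - (T f : BddFun Γ) x ∧
    (S f : BddFun Γ) x - (T f : BddFun Γ) x ≤ (c + d) * (f : BddFun Γ) x
  constructor <;> linarith [h1.1, h1.2, h2.1, h2.2]

/-- Operators in the ideal center act as multiplications at the extreme states. -/
theorem extreme_apply_idealCenter {h1 : (1 : BddFun Γ) ∈ W} {φ : WeakDual ℝ W}
    (hφ : φ ∈ (stateSpace W ⟨1, h1⟩).extremePoints ℝ) {T : W →L[ℝ] W} (hT : T ∈ idealCenter W)
    (f : W) : φ (T f) = φ (T ⟨1, h1⟩) * φ f := by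
  obtain ⟨c, hc, hT⟩ := hT
  -- Adding `1` to `c` allows division by `2d`, which turns `-d ≤ T ≤ d` into `0 ≤ (T + d)/2d ≤ 1`.
  set d := c + 1 with hd
  have hd0 : 0 < 2 * d := by linarith
  let ψ : StrongDual ℝ W := (2 * d)⁻¹ •
    ((WeakDual.toStrongDual φ).comp T + d • WeakDual.toStrongDual φ)
  have hψ : ∀ g, ψ g = (2 * d)⁻¹ * (φ (T g) + d * φ g) := fun g => rfl
  have key := eq_mul_of_le_extreme hφ ψ (fun g hg => by
    have hl : 0 ≤ φ (T g + d • g) := stateSpace_apply_nonneg hφ.1 fun x => by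
      change 0 ≤ (T g : BddFun Γ) x + d * (g : BddFun Γ) x
      linarith [(hT g hg x).1, hg x]
    have hu : 0 ≤ φ (d • g - T g) := stateSpace_apply_nonneg hφ.1 fun x => by
      change 0 ≤ d * (g : BddFun Γ) x - (T g : BddFun Γ) x
      linarith [(hT g hg x).2, hg x]
    rw [map_add, map_smul, smul_eq_mul] at hl
    rw [map_sub, map_smul, smul_eq_mul] at hu
    rw [hψ]
    refine ⟨mul_nonneg (inv_nonneg.2 hd0.le) hl, ?_⟩
    rw [inv_mul_le_iff₀ hd0]
    linarith) f
  rw [hψ, hψ, hφ.1.2, mul_assoc] at key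
  have := mul_left_cancel₀ (inv_ne_zero hd0.ne') key
  linarith

/-- The map `T ↦ T 1` is injective on the ideal center. -/
theorem eq_zero_of_mem_idealCenter (h1 : (1 : BddFun Γ) ∈ W) {T : W →L[ℝ] W}
    (hT : T ∈ idealCenter W) (hT1 : T ⟨1, h1⟩ = 0) : T = 0 := by
  ext f : 1
  have hclosed : IsClosed {φ : WeakDual ℝ W | φ (T f) = 0} :=
    isClosed_eq (WeakDual.eval_continuous _) continuous_const
  have hconv : Convex ℝ {φ : WeakDual ℝ W | φ (T f) = 0} := by
    intro φ hφ ψ hψ s t _ _ _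
    change s * φ (T f) + t * ψ (T f) = 0
    rw [Set.mem_ofPred_eq] at hφ hψ
    rw [hφ, hψ, mul_zero, mul_zero, add_zero]
  have hsub : stateSpace W ⟨1, h1⟩ ⊆ {φ : WeakDual ℝ W | φ (T f) = 0} := by
    rw [← closure_convexHull_extremePoints (isCompact_stateSpace W ⟨1, h1⟩)
      (convex_stateSpace W ⟨1, h1⟩)]
    refine closure_minimal (convexHull_min (fun φ hφ => ?_) hconv) hclosed
    rw [Set.mem_ofPred_eq, extreme_apply_idealCenter hφ hT, hT1, map_zero, zero_mul]
  refine Subtype.ext (lp.ext (funext fun x => ?_))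
  exact hsub (evalState W h1 x).2

end IdealCenter

/-! ### Functions on the state space -/

section StateEval

variable {Γ : Type*} (W : Submodule ℝ (BddFun Γ)) (h1 : (1 : BddFun Γ) ∈ W)

/-- An element `a` of `W`, regarded as the continuous affine function `φ ↦ φ a` on the state space
of `W`. -/
def stateEval : W →ₗᵢ[ℝ] affineCont (stateSpace W ⟨1, h1⟩) where
  toFun a := ⟨⟨fun φ => φ.1 a, memℓp_infty ⟨‖a‖, by
      rintro _ ⟨φ, rfl⟩
      exact stateSpace_apply_le_norm φ.2 a⟩⟩,
    fun x y z s t _ _ _ h => by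
      change z.1 a = s * x.1 a + t * y.1 a
      rw [h]
      rfl,
    (WeakDual.eval_continuous a).comp continuous_subtype_val⟩
  map_add' a b := Subtype.ext (lp.ext (funext fun φ => map_add φ.1 a b))
  map_smul' c a := Subtype.ext (lp.ext (funext fun φ => map_smul φ.1 c a))
  norm_map' a := by
    refine le_antisymm ?_ ?_
    · exact lp.norm_le_of_forall_le (norm_nonneg a) fun φ => stateSpace_apply_le_norm φ.2 a
    · refine lp.norm_le_of_forall_le (norm_nonneg _) fun x => ?_
      let F : BddFun (stateSpace W ⟨1, h1⟩) := ⟨fun φ => φ.1 a, memℓp_infty ⟨‖a‖, by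
        rintro _ ⟨φ, rfl⟩
        exact stateSpace_apply_le_norm φ.2 a⟩⟩
      exact lp.norm_apply_le_norm ENNReal.top_ne_zero F (evalState W h1 x)

variable {W}

theorem stateEval_one :
    stateEval W h1 ⟨1, h1⟩ = ⟨1, one_mem_affineCont (stateSpace W ⟨1, h1⟩)⟩ :=
  Subtype.ext (lp.ext (funext fun φ => φ.2.2))

theorem stateEval_nonneg_iff (a : W) :
    (∀ φ, 0 ≤ (stateEval W h1 a : BddFun (stateSpace W ⟨1, h1⟩)) φ) ↔ ∀ x, 0 ≤ (a : BddFun Γ) x :=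
  ⟨fun h x => h (evalState W h1 x), fun h φ => stateSpace_apply_nonneg φ.2 h⟩

/-- A continuous affine function `g` on the state space of `A` is a uniform limit of functions
`φ ↦ φ a`: the graph of `g` and its translate by `ε` are disjoint compact convex sets, and a
hyperplane that separates them is the graph of such a function. -/
theorem exists_forall_abs_sub_apply_le {A : Type*} [NormedAddCommGroup A] [NormedSpace ℝ A] (e : A)
    {g : stateSpace A e → ℝ} (hg : IsAffine (stateSpace A e) g) (hgc : Continuous g)
    {ε : ℝ} (hε : 0 < ε) : ∃ a : A, ∀ φ, |g φ - φ.1 a| ≤ ε := by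
  obtain hempty | ⟨⟨φ₀⟩⟩ := isEmpty_or_nonempty (stateSpace A e)
  · exact ⟨0, fun φ => isEmptyElim φ⟩
  have hcomp : CompactSpace (stateSpace A e) :=
    isCompact_iff_compactSpace.1 (isCompact_stateSpace A e)
  let G : ℝ → Set (WeakDual ℝ A × ℝ) :=
    fun r => Set.range fun φ : stateSpace A e => (φ.1, g φ + r)
  have hGcomp : ∀ r, IsCompact (G r) := fun r =>
    isCompact_range (continuous_subtype_val.prodMk (hgc.add continuous_const))
  have hGconv : ∀ r, Convex ℝ (G r) := by
    rintro r _ ⟨φ, rfl⟩ _ ⟨ψ, rfl⟩ s t hs ht hst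
    refine ⟨⟨s • φ.1 + t • ψ.1, convex_stateSpace A _ φ.2 ψ.2 hs ht hst⟩, ?_⟩
    refine Prod.ext rfl ?_
    change g _ + r = s * (g φ + r) + t * (g ψ + r)
    rw [hg φ ψ _ s t hs ht hst rfl]
    linear_combination (-r) * hst
  have hdisj : Disjoint (G 0) (G ε) := by
    rw [Set.disjoint_left]
    rintro _ ⟨φ, rfl⟩ ⟨ψ, h⟩
    have h' := Prod.ext_iff.1 h
    have hφψ : ψ = φ := Subtype.ext h'.1
    have := h'.2
    rw [hφψ] at this
    simp only at this
    linarith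
  obtain ⟨F, u, v, hFu, huv, hFv⟩ := geometric_hahn_banach_compact_closed (hGconv 0) (hGcomp 0)
    (hGconv ε) (hGcomp ε).isClosed hdisj
  -- The weak* continuous part of `F` is evaluation at some `a`, and its slope `r` is positive.
  obtain ⟨a, ha⟩ := LinearMap.dualEmbedding_surjective (topDualPairing ℝ A)
    (F.comp (ContinuousLinearMap.inl ℝ (WeakDual ℝ A) ℝ))
  set r := F (0, 1)
  have hF : ∀ (φ : WeakDual ℝ A) (t : ℝ), F (φ, t) = φ a + t * r := by
    intro φ t
    have h2 : F (φ, 0) = φ a := (DFunLike.congr_fun ha φ).symm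
    have h3 : ((φ, t) : WeakDual ℝ A × ℝ) = (φ, 0) + t • (0, 1) := by simp
    rw [h3, map_add, map_smul, h2, smul_eq_mul]
  have hlow : ∀ φ : stateSpace A e, φ.1 a + g φ * r < u := fun φ => by
    have := hFu _ ⟨φ, rfl⟩
    rwa [hF, add_zero] at this
  have hupp : ∀ φ : stateSpace A e, v < φ.1 a + (g φ + ε) * r := fun φ => by
    have := hFv _ ⟨φ, rfl⟩
    rwa [hF] at this
  have hr0 : 0 < r := by
    have : 0 < ε * r := by linarith [hlow φ₀, hupp φ₀]
    exact pos_of_mul_pos_right this hε.le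
  refine ⟨r⁻¹ • (u • e - a), fun φ => ?_⟩
  rw [map_smul, map_sub, map_smul, φ.2.2, smul_eq_mul, smul_eq_mul, mul_one]
  have e : g φ - r⁻¹ * (u - φ.1 a) = (g φ * r - (u - φ.1 a)) / r := by
    field_simp
  rw [e, abs_le, le_div_iff₀ hr0, div_le_iff₀ hr0]
  constructor <;> linarith [hlow φ, hupp φ, mul_pos hε hr0]

theorem stateEval_surjective [CompleteSpace W] : Function.Surjective (stateEval W h1) := by
  have hclosed : IsClosed (Set.range (stateEval W h1)) :=
    (stateEval W h1).isometry.isClosedEmbedding.isClosed_range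
  intro g
  change g ∈ Set.range (stateEval W h1)
  rw [← hclosed.closure_eq, Metric.mem_closure_iff]
  intro ε hε
  obtain ⟨a, ha⟩ := exists_forall_abs_sub_apply_le (⟨1, h1⟩ : W) g.2.1 g.2.2 (half_pos hε)
  refine ⟨_, ⟨a, rfl⟩, ?_⟩
  rw [dist_eq_norm]
  exact (lp.norm_le_of_forall_le (half_pos hε).le ha).trans_lt (half_lt_self hε)

end StateEval

/-! ### Order isomorphisms and the ideal center -/

section Conjugation

variable {Γ Δ : Type*} {V : Submodule ℝ (BddFun Γ)} {W : Submodule ℝ (BddFun Δ)}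

/-- Conjugation by an order isomorphism preserves the ideal center. -/
theorem conj_mem_idealCenter (J : V ≃ₗᵢ[ℝ] W)
    (hJ : ∀ a : V, (∀ y, 0 ≤ (J a : BddFun Δ) y) ↔ ∀ x, 0 ≤ (a : BddFun Γ) x)
    {T : V →L[ℝ] V} (hT : T ∈ idealCenter V) :
    (J.toContinuousLinearEquiv : V →L[ℝ] W) ∘L T ∘L
      (J.symm.toContinuousLinearEquiv : W →L[ℝ] V) ∈ idealCenter W := by
  obtain ⟨c, hc, hT⟩ := hT
  refine ⟨c, hc, fun f hf y => ?_⟩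
  obtain ⟨a, rfl⟩ := J.surjective f
  have ha := (hJ a).1 hf
  have hl := (hJ (T a + c • a)).2 (fun x => by
    change 0 ≤ (T a : BddFun Γ) x + c * (a : BddFun Γ) x
    linarith [(hT a ha x).1]) y
  have hu := (hJ (c • a - T a)).2 (fun x => by
    change 0 ≤ c * (a : BddFun Γ) x - (T a : BddFun Γ) x
    linarith [(hT a ha x).2]) y
  rw [J.map_add, J.map_smul] at hl
  rw [J.map_sub, J.map_smul] at hu
  change 0 ≤ (J (T a) : BddFun Δ) y + c * (J a : BddFun Δ) y at hl
  change 0 ≤ c * (J a : BddFun Δ) y - (J (T a) : BddFun Δ) y at hu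
  change -(c * (J a : BddFun Δ) y) ≤ (J (T (J.symm (J a))) : BddFun Δ) y ∧
    (J (T (J.symm (J a))) : BddFun Δ) y ≤ c * (J a : BddFun Δ) y
  rw [J.symm_apply_apply]
  constructor <;> linarith

/-- Multiplicativity of the ideal center at a point is invariant under order isomorphisms. -/
theorem idealCenter_apply_eq_mul_of_equiv (J : V ≃ₗᵢ[ℝ] W)
    (hJ : ∀ a : V, (∀ y, 0 ≤ (J a : BddFun Δ) y) ↔ ∀ x, 0 ≤ (a : BddFun Γ) x)
    {x : Γ} {y : Δ} (hxy : ∀ a : V, (J a : BddFun Δ) y = (a : BddFun Γ) x) {e : V} {e' : W}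
    (he : J e = e')
    (h : ∀ T ∈ idealCenter W, ∀ b : W,
      (T b : BddFun Δ) y = (T e' : BddFun Δ) y * (b : BddFun Δ) y)
    {T : V →L[ℝ] V} (hT : T ∈ idealCenter V) (a : V) :
    (T a : BddFun Γ) x = (T e : BddFun Γ) x * (a : BddFun Γ) x := by
  have key := h _ (conj_mem_idealCenter J hJ hT) (J a)
  rw [← he] at key
  change (J (T (J.symm (J a))) : BddFun Δ) y =
    (J (T (J.symm (J e))) : BddFun Δ) y * (J a : BddFun Δ) y at key
  rwa [J.symm_apply_apply, J.symm_apply_apply, hxy, hxy, hxy] at key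

/-- The condition defining `multSet`, transported from `A_c` of the state space back to `V`. -/
theorem image_evalState_subset_multSet_iff [CompleteSpace V] (h1 : (1 : BddFun Γ) ∈ V)
    (P : Set Γ) :
    evalState V h1 '' P ⊆ multSet (stateSpace V ⟨1, h1⟩) ↔
      ∀ x ∈ P, ∀ T ∈ idealCenter V, ∀ a : V,
        (T a : BddFun Γ) x = (T ⟨1, h1⟩ : BddFun Γ) x * (a : BddFun Γ) x := by
  obtain ⟨J, hJeq⟩ : ∃ J : V ≃ₗᵢ[ℝ] affineCont (stateSpace V ⟨1, h1⟩),
      ∀ a, J a = stateEval V h1 a :=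
    ⟨LinearIsometryEquiv.ofSurjective (stateEval V h1) (stateEval_surjective h1), fun _ => rfl⟩
  have hJ : ∀ a : V, (∀ φ, 0 ≤ (J a : BddFun (stateSpace V ⟨1, h1⟩)) φ) ↔
      ∀ x, 0 ≤ (a : BddFun Γ) x := fun a => by
    rw [hJeq]
    exact stateEval_nonneg_iff h1 a
  have hJ1 : J ⟨1, h1⟩ = ⟨1, one_mem_affineCont (stateSpace V ⟨1, h1⟩)⟩ :=
    (hJeq _).trans (stateEval_one h1)
  have hJe : ∀ (x : Γ) (a : V),
      (J a : BddFun (stateSpace V ⟨1, h1⟩)) (evalState V h1 x) = (a : BddFun Γ) x := fun x a => by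
    rw [hJeq]
    rfl
  rw [Set.image_subset_iff]
  refine ⟨fun h x hx T hT => idealCenter_apply_eq_mul_of_equiv J hJ (hJe x) hJ1 (h hx) hT,
    fun h x hx T hT => idealCenter_apply_eq_mul_of_equiv J.symm (fun b => ?_) (fun b => ?_) ?_
      (h x hx) hT⟩
  · rw [← hJ, J.apply_symm_apply]
  · rw [← hJe, J.apply_symm_apply]
  · rw [← hJ1, J.symm_apply_apply]

end Conjugation

/-! ### Multipliers -/

section Multipliers

variable {E : Type*} [AddCommGroup E] [Module ℝ E] {X : Set E} {H : Submodule ℝ (BddFun X)}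

theorem DeterminedByExtremePoints.nonneg (hext : DeterminedByExtremePoints X H)
    {u : BddFun X} (hu : u ∈ H) (h : ∀ x ∈ extPts X, 0 ≤ u x) (x : X) : 0 ≤ u x :=
  (Real.sInf_nonneg (by rintro _ ⟨y, hy, rfl⟩; exact h y hy)).trans (hext u hu x).1

theorem DeterminedByExtremePoints.eq_of_eqOn (hext : DeterminedByExtremePoints X H)
    {u v : BddFun X} (hu : u ∈ H) (hv : v ∈ H) (h : ∀ x ∈ extPts X, u x = v x) : u = v := by
  refine lp.ext (funext fun x => le_antisymm ?_ ?_)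
  · exact sub_nonneg.1 (hext.nonneg (H.sub_mem hv hu) (fun y hy => sub_nonneg.2 (h y hy).le) x)
  · exact sub_nonneg.1 (hext.nonneg (H.sub_mem hu hv) (fun y hy => sub_nonneg.2 (h y hy).ge) x)

theorem DeterminedByExtremePoints.norm_le (hext : DeterminedByExtremePoints X H)
    (h1 : (1 : BddFun X) ∈ H) {u : BddFun X} (hu : u ∈ H) {C : ℝ} (hC : 0 ≤ C)
    (h : ∀ x ∈ extPts X, |u x| ≤ C) : ‖u‖ ≤ C := by
  refine lp.norm_le_of_forall_le hC fun x => abs_le.2 ⟨?_, ?_⟩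
  · have := hext.nonneg (u := C • 1 + u) (H.add_mem (H.smul_mem C h1) hu) (fun y hy => by
      change 0 ≤ C * 1 + u y
      linarith [(abs_le.1 (h y hy)).1]) x
    change 0 ≤ C * 1 + u x at this
    linarith
  · have := hext.nonneg (u := C • 1 - u) (H.sub_mem (H.smul_mem C h1) hu) (fun y hy => by
      change 0 ≤ C * 1 - u y
      linarith [(abs_le.1 (h y hy)).2]) x
    change 0 ≤ C * 1 - u x at this
    linarith

/-- A multiplier `u` acts on `H` by an operator of the ideal center. -/
theorem exists_mem_idealCenter_of_mem_multipliers (hext : DeterminedByExtremePoints X H)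
    (h1 : (1 : BddFun X) ∈ H) {u : BddFun X} (hu : u ∈ multipliers X H) :
    ∃ T ∈ idealCenter H, (T ⟨1, h1⟩ : BddFun X) = u ∧
      ∀ a : H, ∀ x ∈ extPts X, (T a : BddFun X) x = u x * (a : BddFun X) x := by
  obtain ⟨hu, hM⟩ := hu
  choose B hBH hB using hM
  have hux : ∀ x, |u x| ≤ ‖u‖ := fun x => abs_apply_le_norm ⟨u, hu⟩ x
  let L : H →ₗ[ℝ] H :=
    { toFun := fun a => ⟨B a a.2, hBH a a.2⟩
      map_add' := fun a b => Subtype.ext <| hext.eq_of_eqOn (hBH _ _)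
        (H.add_mem (hBH a a.2) (hBH b b.2)) fun x hx => by
          change B _ _ x = B a a.2 x + B b b.2 x
          rw [hB _ _ x hx, hB _ _ x hx, hB _ _ x hx]
          exact mul_add _ _ _
      map_smul' := fun c a => Subtype.ext <| hext.eq_of_eqOn (hBH _ _)
        (H.smul_mem c (hBH a a.2)) fun x hx => by
          change B _ _ x = c * B a a.2 x
          rw [hB _ _ x hx, hB _ _ x hx]
          exact mul_left_comm _ _ _ }
  have hL : ∀ a : H, ∀ x ∈ extPts X, (L a : BddFun X) x = u x * (a : BddFun X) x :=
    fun a x hx => hB a a.2 x hx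
  refine ⟨L.mkContinuous ‖u‖ fun a => ?_, ⟨‖u‖, norm_nonneg u, fun f hf x => ?_⟩, ?_, hL⟩
  · refine hext.norm_le h1 (L a).2 (by positivity) fun x hx => ?_
    rw [hL a x hx, abs_mul]
    exact mul_le_mul (hux x) (abs_apply_le_norm a x) (abs_nonneg _) (norm_nonneg u)
  · have hl := hext.nonneg (H.add_mem (L f).2 (H.smul_mem ‖u‖ f.2)) (fun y hy => by
      change 0 ≤ (L f : BddFun X) y + ‖u‖ * (f : BddFun X) y
      rw [hL f y hy, ← add_mul]
      exact mul_nonneg (by linarith [(abs_le.1 (hux y)).1]) (hf y)) x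
    have hg := hext.nonneg (H.sub_mem (H.smul_mem ‖u‖ f.2) (L f).2) (fun y hy => by
      change 0 ≤ ‖u‖ * (f : BddFun X) y - (L f : BddFun X) y
      rw [hL f y hy, ← sub_mul]
      exact mul_nonneg (by linarith [(abs_le.1 (hux y)).2]) (hf y)) x
    change 0 ≤ (L f : BddFun X) x + ‖u‖ * (f : BddFun X) x at hl
    change 0 ≤ ‖u‖ * (f : BddFun X) x - (L f : BddFun X) x at hg
    change -(‖u‖ * (f : BddFun X) x) ≤ (L f : BddFun X) x ∧
      (L f : BddFun X) x ≤ ‖u‖ * (f : BddFun X) x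
    constructor <;> linarith
  · exact hext.eq_of_eqOn (L ⟨1, h1⟩).2 hu fun x hx => (hL ⟨1, h1⟩ x hx).trans (mul_one (u x))

theorem multipliers_subset_center (hext : DeterminedByExtremePoints X H)
    (h1 : (1 : BddFun X) ∈ H) : multipliers X H ⊆ center H h1 := fun _ hu =>
  let ⟨T, hT, hT1, _⟩ := exists_mem_idealCenter_of_mem_multipliers hext h1 hu
  ⟨T, hT, hT1.symm⟩

end Multipliers

end CompactConvex

end

theorem mainTheorem4 {E : Type*} [AddCommGroup E] [Module ℝ E] [TopologicalSpace E]
    [IsTopologicalAddGroup E] [ContinuousSMul ℝ E] [LocallyConvexSpace ℝ E] [T2Space E]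
    (X : Set E) (hXcompact : IsCompact X) (hXconvex : Convex ℝ X)
    (H : Submodule ℝ (CompactConvex.BddFun X))
    (hH : CompactConvex.IsIntermediateFunctionSpace X H)
    (hext : CompactConvex.DeterminedByExtremePoints X H) :
    CompactConvex.center H hH.one_mem = CompactConvex.multipliers X H ↔
      CompactConvex.evalState H hH.one_mem '' CompactConvex.extPts X ⊆
        CompactConvex.multSet (CompactConvex.stateSpace H ⟨1, hH.one_mem⟩) := by
  open CompactConvex in
  have hcomplete : CompleteSpace H := hH.isClosed.completeSpace_coe
  rw [image_evalState_subset_multSet_iff]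
  constructor
  · intro h x hx T hT a
    have hT1 : (T ⟨1, hH.one_mem⟩ : BddFun X) ∈ multipliers X H := h ▸ ⟨T, hT, rfl⟩
    obtain ⟨S, hS, hS1, hSa⟩ :=
      exists_mem_idealCenter_of_mem_multipliers hext hH.one_mem hT1
    have hTS : T = S := sub_eq_zero.1 <| eq_zero_of_mem_idealCenter hH.one_mem
      (sub_mem_idealCenter hT hS) (sub_eq_zero.2 (Subtype.ext hS1.symm))
    rw [← hSa a x hx, hTS]
  · refine fun h => (multipliers_subset_center hext hH.one_mem).antisymm' ?_
    rintro _ ⟨T, hT, rfl⟩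
    exact ⟨(T _).2, fun a ha => ⟨T ⟨a, ha⟩, (T _).2, fun x hx => h x hx T hT ⟨a, ha⟩⟩⟩
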